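/- \textbf{The machine.} Terms, stacks and processes are given by $$t ::= x \mid \lambda x.t \mid t\,t \mid \mathsf{cc} \mid \mathsf{k}_\pi \mid \mathsf{r} \mid \mathsf{w0} \mid \mathsf{w1} \mid \mathsf{end},\qquad \pi ::= \varepsilon \mid t\cdot\pi\ (t\text{ closed}),\qquad p ::= t\star\pi\ (t\text{ closed}) \mid \top .$$ Evaluation $\succ$ is the relation on processes given by $tu\star\pi\succ t\star u\cdot\pi$; $\ (\lambda x.t)\star u\cdot\pi\succ t[u/x]\star\pi$; $\ \mathsf{cc}\star t\cdot\pi\succ t\star\mathsf{k}_\pi\cdot\pi$; $\ \mathsf{k}_\pi\star t\cdot\rho\succ t\star\pi$. The execution relation $\leadsto$ on triples $(p,\iota,o)$ of a process and two binary strings $\iota,o\in\{0,1\}^*$ (input and output) is given by $(p,\iota,o)\leadsto(q,\iota,o)$ whenever $p\succ q$; $(\mathsf{r}\star t\cdot u\cdot v\cdot\pi,\ 0\iota,\ o)\leadsto(t\star\pi,\iota,o)$; $(\mathsf{r}\star t\cdot u\cdot v\cdot\pi,\ 1\iota,\ o)\leadsto(u\star\pi,\iota,o)$; $(\mathsf{r}\star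 t\cdot u\cdot v\cdot\pi,\ \varepsilon,\ o)\leadsto(v\star\pi,\varepsilon,o)$; $(\mathsf{w0}\star t\cdot\pi,\iota,o)\leadsto(t\star\pi,\iota,0o)$; $(\mathsf{w1}\star t\cdot\pi,\iota,o)\leadsto(t\star\pi,\iota,1o)$; $(\mathsf{end}\star\pi,\iota,o)\leadsto(\top,\iota,o)$. \textbf{Poles.} A \emph{pole} is a set $P$ of processes such that $p\in P$ and $p'\succ p$ imply $p'\in P$. A \emph{proof-like} term is a closed term containing none of $\mathsf r,\mathsf{w0},\mathsf{w1},\mathsf{end}$. A pole $P$ is \emph{consistent} if falsity is not valid, i.e. if no proof-like term $t$ satisfies $t\star\pi\in P$ for all stacks $\pi$. Let $\mathrm{bin}(n)$ be the base $2$ representation of $n\in\mathbb N$, most significant bit first, with $\mathrm{bin}(0)=\varepsilon$. A process $p$ \emph{implements} a partial function $f:\mathbb N\rightharpoonup\mathbb N$ if $(p,\mathrm{bin}(n),\varepsilon)\leadsto^*(\top,\varepsilon,\mathrm{bin}(f(n)))$ for all $n\in\mathrm{dom}(f)$; nothing is required for $n\notin\mathrm{dom}(f)$. The set $\perp\!\!\!\perp_f$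 of all processes that implement $f$ is a pole. \textbf{Theorem.} Let $f:\mathbb N\rightharpoonup\mathbb N$ be a partial function. \begin{itemize} \item $\perp\!\!\!\perp_f$ is consistent if and only if $f$ is not totally undefined. \item $\perp\!\!\!\perp_f$ is non-empty if and only if $f$ is computable on its domain, i.e. there is a partial recursive function $g:\mathbb N\rightharpoonup\mathbb N$ with $g(n)=f(n)$ for all $n\in\mathrm{dom}(f)$. In particular, $\perp\!\!\!\perp_f$ is non-empty whenever $f$ is partial recursive; and if $\mathrm{dom}(f)$ is recursively enumerable (e.g. if $f$ is total), then $\perp\!\!\!\perp_f$ is non-empty if and only if $f$ is partial recursive. \end{itemize} -/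

import Mathlib

namespace Krivine

mutual

/-- Terms (up to renaming of bound variables) of the Krivine machine with input and output, with
free variables among `n` de Bruijn indices. `Term 0` is the type of closed terms. -/
inductive Term : ℕ → Type
  | var {n : ℕ} (i : Fin n) : Term n
  | lam {n : ℕ} (t : Term (n + 1)) : Term n
  | app {n : ℕ} (t u : Term n) : Term n
  /-- The constant call/cc. -/
  | cc {n : ℕ} : Term n
  /-- The continuation term of a stack. -/
  | cont {n : ℕ} (π : Stack) : Term n
  /-- The instruction that reads one bit. -/
  | rd {n : ℕ} : Term n
  /-- The instruction that writes the bit `0`. -/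
  | wr0 {n : ℕ} : Term n
  /-- The instruction that writes the bit `1`. -/
  | wr1 {n : ℕ} : Term n
  /-- The instruction that terminates. -/
  | halt {n : ℕ} : Term n

/-- Stacks: finite lists of closed terms. -/
inductive Stack : Type
  | nil : Stack
  | push (t : Term 0) (π : Stack) : Stack

end

/-- Machine processes: a closed term against a stack, or the process constant `top`. -/
inductive Proc : Type
  | star (t : Term 0) (π : Stack) : Proc
  | top : Proc

/-- Renaming of free variables (continuation terms are closed). -/
def Term.rename : {n m : ℕ} → (Fin n → Fin m) → Term n → Term m
  | _, _, ρ, .var i => .var (ρ i)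
  | _, _, ρ, .lam t => .lam (t.rename (Fin.cases 0 (fun i => (ρ i).succ)))
  | _, _, ρ, .app t u => .app (t.rename ρ) (u.rename ρ)
  | _, _, _, .cc => .cc
  | _, _, _, .cont π => .cont π
  | _, _, _, .rd => .rd
  | _, _, _, .wr0 => .wr0
  | _, _, _, .wr1 => .wr1
  | _, _, _, .halt => .halt

/-- Capture-avoiding simultaneous substitution. -/
def Term.subst : {n m : ℕ} → (Fin n → Term m) → Term n → Term m
  | _, _, σ, .var i => σ i
  | _, _, σ, .lam t => .lam (t.subst (Fin.cases (.var 0) (fun i => (σ i).rename Fin.succ)))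
  | _, _, σ, .app t u => .app (t.subst σ) (u.subst σ)
  | _, _, _, .cc => .cc
  | _, _, _, .cont π => .cont π
  | _, _, _, .rd => .rd
  | _, _, _, .wr0 => .wr0
  | _, _, _, .wr1 => .wr1
  | _, _, _, .halt => .halt

/-- `t.inst u` is `t[u]`, for a term `t` in one free variable and a closed term `u`. -/
def Term.inst (t : Term 1) (u : Term 0) : Term 0 := t.subst (fun _ => u)

/-- Evaluation `p ≻ q`, the effect-free transitions. -/
inductive Eval : Proc → Proc → Prop
  | push (t u : Term 0) (π : Stack) : Eval (.star (.app t u) π) (.star t (.push u π))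
  | pop (t : Term 1) (u : Term 0) (π : Stack) :
      Eval (.star (.lam t) (.push u π)) (.star (t.inst u) π)
  | save (t : Term 0) (π : Stack) :
      Eval (.star .cc (.push t π)) (.star t (.push (.cont π) π))
  | restore (π : Stack) (t : Term 0) (ρ : Stack) :
      Eval (.star (.cont π) (.push t ρ)) (.star t π)

/-- Execution contexts: a process, the remaining input and the output written so far
(`false` is the bit `0`, `true` is the bit `1`). -/
structure Ctx : Type where
  proc : Proc
  input : List Bool
  output : List Bool

/-- The execution relation on execution contexts. Bits are written at the front of the output. -/
inductive Exec : Ctx → Ctx → Prop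
  | tau {p q : Proc} (h : Eval p q) (i o : List Bool) : Exec ⟨p, i, o⟩ ⟨q, i, o⟩
  | rd0 (t u v : Term 0) (π : Stack) (i o : List Bool) :
      Exec ⟨.star .rd (.push t (.push u (.push v π))), false :: i, o⟩ ⟨.star t π, i, o⟩
  | rd1 (t u v : Term 0) (π : Stack) (i o : List Bool) :
      Exec ⟨.star .rd (.push t (.push u (.push v π))), true :: i, o⟩ ⟨.star u π, i, o⟩
  | rdEmpty (t u v : Term 0) (π : Stack) (o : List Bool) :
      Exec ⟨.star .rd (.push t (.push u (.push v π))), [], o⟩ ⟨.star v π, [], o⟩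
  | wr0 (t : Term 0) (π : Stack) (i o : List Bool) :
      Exec ⟨.star .wr0 (.push t π), i, o⟩ ⟨.star t π, i, false :: o⟩
  | wr1 (t : Term 0) (π : Stack) (i o : List Bool) :
      Exec ⟨.star .wr1 (.push t π), i, o⟩ ⟨.star t π, i, true :: o⟩
  | halt (π : Stack) (i o : List Bool) : Exec ⟨.star .halt π, i, o⟩ ⟨.top, i, o⟩

/-- Base 2 representation, most significant bit first; `0` is represented by the empty string. -/
def bin (n : ℕ) : List Bool := n.bits.reverse

/-- The process `p` implements the partial function `f`; nothing is required outside the domain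
of `f`. -/
def Implements (p : Proc) (f : ℕ →. ℕ) : Prop :=
  ∀ (n : ℕ) (h : (f n).Dom),
    Relation.ReflTransGen Exec ⟨p, bin n, []⟩ ⟨.top, [], bin ((f n).get h)⟩

/-- A pole: a set of processes saturated with respect to (effect-free) evaluation. -/
structure Pole : Type where
  carrier : Set Proc
  saturated : ∀ p p' : Proc, p ∈ carrier → Eval p' p → p' ∈ carrier

/-- The pole of all processes that implement `f`. -/
def implPole (f : ℕ →. ℕ) : Pole where
  carrier := {p | Implements p f}
  saturated := fun _ _ hp h n hn => Relation.ReflTransGen.head (Exec.tau h _ _) (hp n hn)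

mutual

/-- The term contains none of the reading, writing and terminating instructions (continuation
terms are allowed, if their stacks contain none either). -/
def Term.EffectFree : {n : ℕ} → Term n → Prop
  | _, .var _ => True
  | _, .lam t => t.EffectFree
  | _, .app t u => t.EffectFree ∧ u.EffectFree
  | _, .cc => True
  | _, .cont π => π.EffectFree
  | _, .rd => False
  | _, .wr0 => False
  | _, .wr1 => False
  | _, .halt => False

/-- All terms on the stack are free of the instructions for input, output and termination. -/
def Stack.EffectFree : Stack → Prop
  | .nil => True
  | .push t π => t.EffectFree ∧ π.EffectFree

end

/-- The set of proof-like terms. -/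
def PL : Set (Term 0) := {t | t.EffectFree}

/-- Truth values are sets of stacks (to be read as sets of refutations). -/
abbrev TruthValue : Type := Set Stack

/-- The truth value falsity. -/
def falsity : TruthValue := Set.univ

/-- The closed term `t` realizes the truth value `S` with respect to the pole `P`. -/
def Realizes (P : Pole) (t : Term 0) (S : TruthValue) : Prop :=
  ∀ π ∈ S, Proc.star t π ∈ P.carrier

/-- A truth value is valid if it has a proof-like realizer. -/
def Valid (P : Pole) (S : TruthValue) : Prop := ∃ t ∈ PL, Realizes P t S

/-- A pole is consistent if falsity is not valid. -/
def Consistent (P : Pole) : Prop := ¬ Valid P falsity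

end Krivine

/-!
Consistency: evaluation, and hence execution, preserves the absence of input, output and termination
instructions, so a process made from a proof-like term and the empty stack never reaches `top`
(`not_implements_of_effectFree`). If the domain of `f` contains some `n`, falsity therefore has no
proof-like realizer; if it is empty, every process implements `f`.

From a partial recursive function to a process (`exists_implements`): a partial recursive function is
given by a `Turing.ToPartrec.Code`, which acts on lists of numbers. Such codes are compiled by
induction to terms that act on Scott-encoded lists in continuation-passing style
(`exists_computes`). Under call by name, continuation-passing style ensures that numbers and lists
are always passed fully evaluated, so the terms can be specified by literal equality of
processes rather than up to some equivalence. The process reads the input bit by bit while keeping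
the number read so far, runs the compiled function, and writes the result starting with its least
significant bit. Doubling, halving and parity, needed for the conversion, are themselves obtained
from the compiler.

From a process to a partial recursive function (`exists_partrec_of_implements`): execution is
simulated by an environment machine whose configurations are coded by numbers. Since a substitution
is delayed in an environment, a step of this machine only inspects the outermost constructor of the
head term and involves no recursion over terms, which makes it primitive recursive
(`primrec_step`). Each transition of the original machine is matched by finitely many steps
(`Rep.exists_of_exec`), as variables in head position have to be looked up first. An unbounded search
for a halting configuration then computes an extension of `f`. If the domain of `f` is recursively
enumerable, the extension can be restricted to it (`partrec_of_rePred_dom`).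
-/

namespace Krivine

/-! ### Substitution -/

/-- Extension of a renaming under a binder. -/
abbrev liftR {n m : ℕ} (ρ : Fin n → Fin m) : Fin (n + 1) → Fin (m + 1) :=
  Fin.cases 0 (fun i => (ρ i).succ)

/-- Extension of a substitution under a binder. -/
abbrev liftS {n m : ℕ} (σ : Fin n → Term m) : Fin (n + 1) → Term (m + 1) :=
  Fin.cases (.var 0) (fun i => (σ i).rename Fin.succ)

theorem Term.rename_rename : {n m k : ℕ} → (t : Term n) → (ρ : Fin n → Fin m) →
    (τ : Fin m → Fin k) → (t.rename ρ).rename τ = t.rename (fun i => τ (ρ i))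
  | _, _, _, .var _, _, _ => rfl
  | _, _, _, .lam t, ρ, τ => by
    have h : (fun i => liftR τ (liftR ρ i)) = liftR (fun i => τ (ρ i)) := by
      funext i; cases i using Fin.cases <;> rfl
    simp only [Term.rename]
    exact congrArg Term.lam ((t.rename_rename _ _).trans (congrArg (Term.rename · t) h))
  | _, _, _, .app t u, ρ, τ => by simp only [Term.rename, t.rename_rename, u.rename_rename]
  | _, _, _, .cc, _, _ => rfl
  | _, _, _, .cont _, _, _ => rfl
  | _, _, _, .rd, _, _ => rfl
  | _, _, _, .wr0, _, _ => rfl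
  | _, _, _, .wr1, _, _ => rfl
  | _, _, _, .halt, _, _ => rfl

theorem Term.subst_rename : {n m k : ℕ} → (t : Term n) → (ρ : Fin n → Fin m) →
    (σ : Fin m → Term k) → (t.rename ρ).subst σ = t.subst (fun i => σ (ρ i))
  | _, _, _, .var _, _, _ => rfl
  | _, _, _, .lam t, ρ, σ => by
    have h : (fun i => liftS σ (liftR ρ i)) = liftS (fun i => σ (ρ i)) := by
      funext i; cases i using Fin.cases <;> rfl
    simp only [Term.rename, Term.subst]
    exact congrArg Term.lam ((t.subst_rename _ _).trans (congrArg (Term.subst · t) h))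
  | _, _, _, .app t u, ρ, σ => by
    simp only [Term.rename, Term.subst, t.subst_rename, u.subst_rename]
  | _, _, _, .cc, _, _ => rfl
  | _, _, _, .cont _, _, _ => rfl
  | _, _, _, .rd, _, _ => rfl
  | _, _, _, .wr0, _, _ => rfl
  | _, _, _, .wr1, _, _ => rfl
  | _, _, _, .halt, _, _ => rfl

theorem Term.rename_subst : {n m k : ℕ} → (t : Term n) → (σ : Fin n → Term m) →
    (ρ : Fin m → Fin k) → (t.subst σ).rename ρ = t.subst (fun i => (σ i).rename ρ)
  | _, _, _, .var _, _, _ => rfl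
  | _, _, _, .lam t, σ, ρ => by
    have h : (fun i => (liftS σ i).rename (liftR ρ)) = liftS (fun i => (σ i).rename ρ) := by
      funext i
      cases i using Fin.cases with
      | zero => rfl
      | succ i => simp only [liftS, Fin.cases_succ, Term.rename_rename]
    simp only [Term.rename, Term.subst]
    exact congrArg Term.lam ((t.rename_subst _ _).trans (congrArg (Term.subst · t) h))
  | _, _, _, .app t u, σ, ρ => by
    simp only [Term.rename, Term.subst, t.rename_subst, u.rename_subst]
  | _, _, _, .cc, _, _ => rfl
  | _, _, _, .cont _, _, _ => rfl
  | _, _, _, .rd, _, _ => rfl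
  | _, _, _, .wr0, _, _ => rfl
  | _, _, _, .wr1, _, _ => rfl
  | _, _, _, .halt, _, _ => rfl

theorem Term.subst_subst : {n m k : ℕ} → (t : Term n) → (σ : Fin n → Term m) →
    (τ : Fin m → Term k) → (t.subst σ).subst τ = t.subst (fun i => (σ i).subst τ)
  | _, _, _, .var _, _, _ => rfl
  | _, _, _, .lam t, σ, τ => by
    have h : (fun i => (liftS σ i).subst (liftS τ)) = liftS (fun i => (σ i).subst τ) := by
      funext i
      cases i using Fin.cases with
      | zero => rfl
      | succ i => simp only [liftS, Fin.cases_succ, Term.subst_rename, Term.rename_subst]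
    simp only [Term.subst]
    exact congrArg Term.lam ((t.subst_subst _ _).trans (congrArg (Term.subst · t) h))
  | _, _, _, .app t u, σ, τ => by
    simp only [Term.subst, t.subst_subst, u.subst_subst]
  | _, _, _, .cc, _, _ => rfl
  | _, _, _, .cont _, _, _ => rfl
  | _, _, _, .rd, _, _ => rfl
  | _, _, _, .wr0, _, _ => rfl
  | _, _, _, .wr1, _, _ => rfl
  | _, _, _, .halt, _, _ => rfl

theorem Term.subst_var : {n m : ℕ} → (t : Term n) → (ρ : Fin n → Fin m) →
    t.subst (fun i => .var (ρ i)) = t.rename ρ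
  | _, _, .var _, _ => rfl
  | _, _, .lam t, ρ => by
    have h : liftS (fun i => .var (ρ i)) = fun i => Term.var (liftR ρ i) := by
      funext i; cases i using Fin.cases <;> rfl
    simp only [Term.rename, Term.subst]
    exact congrArg Term.lam ((congrArg (Term.subst · t) h).trans (t.subst_var _))
  | _, _, .app t u, ρ => by simp only [Term.rename, Term.subst, t.subst_var, u.subst_var]
  | _, _, .cc, _ => rfl
  | _, _, .cont _, _ => rfl
  | _, _, .rd, _ => rfl
  | _, _, .wr0, _ => rfl
  | _, _, .wr1, _ => rfl
  | _, _, .halt, _ => rfl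

theorem Term.rename_id : {n : ℕ} → (t : Term n) → t.rename (fun i => i) = t
  | _, .var _ => rfl
  | n, .lam t => by
    have h : liftR (fun i : Fin n => i) = fun i => i := by
      funext i; cases i using Fin.cases <;> rfl
    simp only [Term.rename]
    exact congrArg Term.lam ((congrArg (Term.rename · t) h).trans t.rename_id)
  | _, .app t u => by simp only [Term.rename, t.rename_id, u.rename_id]
  | _, .cc => rfl
  | _, .cont _ => rfl
  | _, .rd => rfl
  | _, .wr0 => rfl
  | _, .wr1 => rfl
  | _, .halt => rfl

/-- A closed term, regarded as a term in any number of variables. -/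
def Term.weaken {n : ℕ} (t : Term 0) : Term n := t.rename Fin.elim0

@[simp] theorem Term.rename_closed {n : ℕ} (t : Term 0) (ρ : Fin 0 → Fin n) :
    t.rename ρ = t.weaken :=
  congrArg (Term.rename · t) (Subsingleton.elim _ _)

@[simp] theorem Term.subst_closed {n : ℕ} (t : Term 0) (σ : Fin 0 → Term n) :
    t.subst σ = t.weaken := by
  rw [← t.rename_closed Fin.elim0, ← t.subst_var]
  exact congrArg (Term.subst · t) (Subsingleton.elim _ _)

@[simp] theorem Term.weaken_zero (t : Term 0) : (t.weaken : Term 0) = t := by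
  rw [← t.rename_closed (fun i => i), t.rename_id]

@[simp] theorem Term.rename_weaken {n m : ℕ} (t : Term 0) (ρ : Fin n → Fin m) :
    (t.weaken : Term n).rename ρ = t.weaken := by
  rw [Term.weaken, Term.rename_rename, Term.rename_closed]

@[simp] theorem Term.subst_weaken {n m : ℕ} (t : Term 0) (σ : Fin n → Term m) :
    (t.weaken : Term n).subst σ = t.weaken := by
  rw [Term.weaken, Term.subst_rename, Term.subst_closed, Term.weaken]

/-- A β-step performed under a delayed substitution extends that substitution. -/
theorem Term.inst_subst_lift {n : ℕ} (t : Term (n + 1)) (σ : Fin n → Term 0) (u : Term 0) :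
    (t.subst (liftS σ)).inst u = t.subst (Fin.cases u σ) := by
  rw [Term.inst, Term.subst_subst]
  congr 1
  funext i
  cases i using Fin.cases with
  | zero => rfl
  | succ i => simp

/-! ### Consistency -/

theorem Term.EffectFree.rename : {n m : ℕ} → (t : Term n) → (ρ : Fin n → Fin m) →
    t.EffectFree → (t.rename ρ).EffectFree
  | _, _, .var _, _, _ => by simp only [Term.rename, Term.EffectFree]
  | _, _, .lam t, ρ, h => by
    simp only [Term.rename, Term.EffectFree] at h ⊢
    exact Term.EffectFree.rename t _ h
  | _, _, .app t u, ρ, h => by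
    simp only [Term.rename, Term.EffectFree] at h ⊢
    exact ⟨Term.EffectFree.rename t _ h.1, Term.EffectFree.rename u _ h.2⟩
  | _, _, .cc, _, h => h
  | _, _, .cont _, _, h => by simpa only [Term.rename, Term.EffectFree] using h
  | _, _, .rd, _, h => h
  | _, _, .wr0, _, h => h
  | _, _, .wr1, _, h => h
  | _, _, .halt, _, h => h

theorem Term.EffectFree.subst : {n m : ℕ} → (t : Term n) → (σ : Fin n → Term m) →
    t.EffectFree → (∀ i, (σ i).EffectFree) → (t.subst σ).EffectFree
  | _, _, .var i, _, _, hσ => hσ i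
  | _, _, .lam t, σ, h, hσ => by
    simp only [Term.subst, Term.EffectFree] at h ⊢
    refine Term.EffectFree.subst t _ h fun i => ?_
    cases i using Fin.cases with
    | zero => simp only [Fin.cases_zero, Term.EffectFree]
    | succ i => exact Term.EffectFree.rename _ _ (hσ i)
  | _, _, .app t u, σ, h, hσ => by
    simp only [Term.subst, Term.EffectFree] at h ⊢
    exact ⟨Term.EffectFree.subst t _ h.1 hσ, Term.EffectFree.subst u _ h.2 hσ⟩
  | _, _, .cc, _, h, _ => h
  | _, _, .cont _, _, h, _ => by simpa only [Term.subst, Term.EffectFree] using h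
  | _, _, .rd, _, h, _ => h
  | _, _, .wr0, _, h, _ => h
  | _, _, .wr1, _, h, _ => h
  | _, _, .halt, _, h, _ => h

/-- The process is not `top`, and neither its term nor its stack contains an instruction for input,
output or termination. -/
def Proc.EffectFree : Proc → Prop
  | .star t π => t.EffectFree ∧ π.EffectFree
  | .top => False

theorem Eval.effectFree {p q : Proc} (h : Eval p q) (hp : p.EffectFree) : q.EffectFree := by
  cases h <;> simp only [Proc.EffectFree, Term.EffectFree, Stack.EffectFree] at hp ⊢
  case push => tauto
  case pop => exact ⟨Term.EffectFree.subst _ _ hp.1 fun _ => hp.2.1, hp.2.2⟩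
  case save => tauto
  case restore => tauto

theorem Exec.effectFree {c d : Ctx} (h : Exec c d) (hc : c.proc.EffectFree) :
    d.proc.EffectFree := by
  cases h
  case tau h i o => exact h.effectFree hc
  all_goals simp [Proc.EffectFree, Term.EffectFree] at hc

/-- An effect-free process stays effect-free during execution, so it never reaches `top`. -/
theorem not_implements_of_effectFree {p : Proc} (hp : p.EffectFree) {f : ℕ →. ℕ} {n : ℕ}
    (hn : (f n).Dom) : ¬ Implements p f := by
  intro h
  have key : ∀ c, Relation.ReflTransGen Exec ⟨p, bin n, []⟩ c → c.proc.EffectFree := by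
    intro c hc
    induction hc with
    | refl => exact hp
    | tail _ hs ih => exact hs.effectFree ih
  exact key _ (h n hn)

theorem consistent_implPole_iff (f : ℕ →. ℕ) :
    Consistent (implPole f) ↔ ∃ n : ℕ, (f n).Dom := by
  constructor
  · intro h
    by_contra hf
    refine h ⟨.cc, by simp [PL, Term.EffectFree], fun π _ n hn => (hf ⟨n, hn⟩).elim⟩
  · rintro ⟨n, hn⟩ ⟨t, ht, h⟩
    exact not_implements_of_effectFree (p := .star t .nil) ⟨ht, by simp [Stack.EffectFree]⟩ hn
      (h .nil (Set.mem_univ _))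

/-! ### Scott numerals and lists -/

/-- The Scott numeral of `n`: applied to `z` and `s` it reduces to `z` if `n = 0`, and to `s` applied
to the numeral of `n - 1` otherwise. -/
def numeral : ℕ → Term 0
  | 0 => .lam (.lam (.var 1))
  | n + 1 => .lam (.lam (.app (.var 0) (numeral n).weaken))

/-- The Scott encoding of a list of numbers: applied to `a` and `b` it reduces to `a` if the list is
empty, and to `b` applied to head and tail otherwise. -/
def list : List ℕ → Term 0
  | [] => .lam (.lam (.var 1))
  | n :: v => .lam (.lam (.app (.app (.var 0) (numeral n).weaken) (list v).weaken))

/-- The reflexive transitive closure of evaluation. -/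
abbrev Evals : Proc → Proc → Prop := Relation.ReflTransGen Eval

theorem Evals.push {t u : Term 0} {π : Stack} {q : Proc} (h : Evals (.star t (.push u π)) q) :
    Evals (.star (.app t u) π) q := .head (.push t u π) h

theorem Evals.pop {t : Term 1} {u : Term 0} {π : Stack} {q : Proc}
    (h : Evals (.star (t.subst fun _ => u) π) q) :
    Evals (.star (.lam t) (.push u π)) q := .head (.pop t u π) h

/-- The term `t` computes the value `w` from the list `v` in continuation-passing style. -/
def Computes (t : Term 0) (v w : List ℕ) : Prop :=
  ∀ (k : Term 0) (π : Stack),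
    Evals (.star t (.push (list v) (.push k π))) (.star k (.push (list w) π))

section Variables

variable {α : Type*} {n : ℕ} (a : α)

theorem cases_one (f : Fin (n + 1) → α) :
    (Fin.cases a f (1 : Fin (n + 2)) : α) = f 0 := rfl

theorem cases_two (f : Fin (n + 2) → α) :
    (Fin.cases a f (2 : Fin (n + 3)) : α) = f 1 := rfl

theorem cases_three (f : Fin (n + 3) → α) :
    (Fin.cases a f (3 : Fin (n + 4)) : α) = f 2 := rfl

theorem cases_four (f : Fin (n + 4) → α) :
    (Fin.cases a f (4 : Fin (n + 5)) : α) = f 3 := rfl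

theorem cases_five (f : Fin (n + 5) → α) :
    (Fin.cases a f (5 : Fin (n + 6)) : α) = f 4 := rfl

theorem cases_six (f : Fin (n + 6) → α) :
    (Fin.cases a f (6 : Fin (n + 7)) : α) = f 5 := rfl

end Variables

/- With these lemmas, `simp` computes the result of a β-step on an explicit term. The evaluations
below repeat `Evals.push` and `Evals.pop` at reducible transparency, so that they stop when a numeral,
a list or a parameter term reaches the head. -/
attribute [local simp] Term.subst Term.rename cases_one cases_two cases_three cases_four cases_five
  cases_six

theorem evals_numeral_zero (z s : Term 0) (π : Stack) :
    Evals (.star (numeral 0) (.push z (.push s π))) (.star z π) := by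
  rw [numeral]
  repeat first | with_reducible apply Evals.push | (with_reducible apply Evals.pop); simp
  exact .refl

theorem evals_numeral_succ (n : ℕ) (z s : Term 0) (π : Stack) :
    Evals (.star (numeral (n + 1)) (.push z (.push s π))) (.star s (.push (numeral n) π)) := by
  rw [numeral]
  repeat first | with_reducible apply Evals.push | (with_reducible apply Evals.pop); simp
  exact .refl

theorem weaken_numeral_succ (n : ℕ) {m : ℕ} :
    ((numeral (n + 1)).weaken : Term m) = .lam (.lam (.app (.var 0) (numeral n).weaken)) := by
  rw [Term.weaken, numeral]
  simp

theorem evals_list_nil (a b : Term 0) (π : Stack) :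
    Evals (.star (list []) (.push a (.push b π))) (.star a π) := by
  rw [list]
  repeat first | with_reducible apply Evals.push | (with_reducible apply Evals.pop); simp
  exact .refl

theorem evals_list_cons (n : ℕ) (v : List ℕ) (a b : Term 0) (π : Stack) :
    Evals (.star (list (n :: v)) (.push a (.push b π)))
      (.star b (.push (numeral n) (.push (list v) π))) := by
  rw [list]
  repeat first | with_reducible apply Evals.push | (with_reducible apply Evals.pop); simp
  exact .refl

/-! ### Compilation of partial recursive functions -/

/-- `λ v k, k (0 :: v)` -/
def zeroTerm : Term 0 := .lam (.lam (.app (.var 0)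
  (.lam (.lam (.app (.app (.var 0) (numeral 0).weaken) (.var 3))))))

/-- `λ v k, v (k [1]) (λ h t, k [h + 1])` -/
def succTerm : Term 0 := .lam (.lam (.app (.app (.var 1) (.app (.var 0) (list [1]).weaken))
  (.lam (.lam (.app (.var 2) (.lam (.lam (.app (.app (.var 0)
    (.lam (.lam (.app (.var 0) (.var 5))))) (list []).weaken))))))))

/-- `λ v k, v (k []) (λ h t, k t)` -/
def tailTerm : Term 0 := .lam (.lam (.app (.app (.var 1) (.app (.var 0) (list []).weaken))
  (.lam (.lam (.app (.var 2) (.var 0))))))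

/-- `λ v k, F v (λ a, G v (λ b, a (k (0 :: b)) (λ h t, k (h :: b))))` -/
def consTerm (F G : Term 0) : Term 0 := .lam (.lam (.app (.app F.weaken (.var 1))
  (.lam (.app (.app G.weaken (.var 2))
    (.lam (.app (.app (.var 1)
      (.app (.var 2) (.lam (.lam (.app (.app (.var 0) (numeral 0).weaken) (.var 2))))))
      (.lam (.lam (.app (.var 4) (.lam (.lam (.app (.app (.var 0) (.var 3)) (.var 4)))))))))))))

/-- `λ v k, G v (λ w, F w k)` -/
def compTerm (F G : Term 0) : Term 0 := .lam (.lam (.app (.app G.weaken (.var 1))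
  (.lam (.app (.app F.weaken (.var 0)) (.var 1)))))

/-- `λ v k, v (F v k) (λ h t, h (F t k) (λ y, G (y :: t) k))` -/
def caseTerm (F G : Term 0) : Term 0 := .lam (.lam (.app (.app (.var 1)
  (.app (.app F.weaken (.var 1)) (.var 0)))
  (.lam (.lam (.app (.app (.var 1) (.app (.app F.weaken (.var 0)) (.var 2)))
    (.lam (.app (.app G.weaken (.lam (.lam (.app (.app (.var 0) (.var 2)) (.var 3))))) (.var 3))))))))

/-- `λ a v k, F v (λ w, w (k []) (λ h t, h (k t) (λ y, a a t k)))`; applied to itself, this term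
iterates `F`. -/
def fixStep (F : Term 0) : Term 0 := .lam (.lam (.lam (.app (.app F.weaken (.var 1))
  (.lam (.app (.app (.var 0) (.app (.var 1) (list []).weaken))
    (.lam (.lam (.app (.app (.var 1) (.app (.var 3) (.var 0)))
      (.lam (.app (.app (.app (.var 6) (.var 6)) (.var 1)) (.var 4)))))))))))

theorem computes_zeroTerm (v : List ℕ) : Computes zeroTerm v (0 :: v) := by
  intro k π
  rw [zeroTerm]
  repeat first | with_reducible apply Evals.push | (with_reducible apply Evals.pop); simp
  exact .refl

theorem computes_succTerm (v : List ℕ) : Computes succTerm v [v.headI.succ] := by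
  intro k π
  rw [succTerm]
  repeat first | with_reducible apply Evals.push | (with_reducible apply Evals.pop); simp
  cases v with
  | nil =>
    refine (evals_list_nil _ _ _).trans ?_
    exact Evals.push .refl
  | cons n v =>
    refine (evals_list_cons _ _ _ _ _).trans ?_
    repeat first | with_reducible apply Evals.push | (with_reducible apply Evals.pop); simp
    simp only [list, weaken_numeral_succ]
    exact .refl

theorem computes_tailTerm (v : List ℕ) : Computes tailTerm v v.tail := by
  intro k π
  rw [tailTerm]
  repeat first | with_reducible apply Evals.push | (with_reducible apply Evals.pop); simp
  cases v with
  | nil =>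
    refine (evals_list_nil _ _ _).trans ?_
    exact Evals.push .refl
  | cons n v =>
    refine (evals_list_cons _ _ _ _ _).trans ?_
    repeat first | with_reducible apply Evals.push | (with_reducible apply Evals.pop); simp
    exact .refl

theorem computes_consTerm {F G : Term 0} {v a b : List ℕ} (hF : Computes F v a)
    (hG : Computes G v b) : Computes (consTerm F G) v (a.headI :: b) := by
  intro k π
  rw [consTerm]
  repeat first | with_reducible apply Evals.push | (with_reducible apply Evals.pop); simp
  refine (hF _ _).trans ?_
  repeat first | with_reducible apply Evals.push | (with_reducible apply Evals.pop); simp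
  refine (hG _ _).trans ?_
  repeat first | with_reducible apply Evals.push | (with_reducible apply Evals.pop); simp
  cases a with
  | nil =>
    refine (evals_list_nil _ _ _).trans ?_
    exact Evals.push .refl
  | cons n a =>
    refine (evals_list_cons _ _ _ _ _).trans ?_
    repeat first | with_reducible apply Evals.push | (with_reducible apply Evals.pop); simp
    exact .refl

theorem computes_compTerm {F G : Term 0} {v w x : List ℕ} (hF : Computes F w x)
    (hG : Computes G v w) : Computes (compTerm F G) v x := by
  intro k π
  rw [compTerm]
  repeat first | with_reducible apply Evals.push | (with_reducible apply Evals.pop); simp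
  refine (hG _ _).trans ?_
  repeat first | with_reducible apply Evals.push | (with_reducible apply Evals.pop); simp
  exact hF _ _

theorem computes_caseTerm_zero {F G : Term 0} {v w : List ℕ} (hv : v.headI = 0)
    (hF : Computes F v.tail w) : Computes (caseTerm F G) v w := by
  intro k π
  rw [caseTerm]
  repeat first | with_reducible apply Evals.push | (with_reducible apply Evals.pop); simp
  cases v with
  | nil =>
    refine (evals_list_nil _ _ _).trans ?_
    exact Evals.push (.push (hF _ _))
  | cons n v =>
    obtain rfl : n = 0 := hv
    refine (evals_list_cons _ _ _ _ _).trans ?_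
    repeat first | with_reducible apply Evals.push | (with_reducible apply Evals.pop); simp
    refine (evals_numeral_zero _ _ _).trans ?_
    exact Evals.push (.push (hF _ _))

theorem computes_caseTerm_succ {F G : Term 0} {v w : List ℕ} {n : ℕ} (hv : v.headI = n + 1)
    (hG : Computes G (n :: v.tail) w) : Computes (caseTerm F G) v w := by
  intro k π
  rw [caseTerm]
  repeat first | with_reducible apply Evals.push | (with_reducible apply Evals.pop); simp
  cases v with
  | nil => cases hv
  | cons m v =>
    obtain rfl : m = n + 1 := hv
    refine (evals_list_cons _ _ _ _ _).trans ?_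
    repeat first | with_reducible apply Evals.push | (with_reducible apply Evals.pop); simp
    refine (evals_numeral_succ _ _ _ _).trans ?_
    repeat first | with_reducible apply Evals.push | (with_reducible apply Evals.pop); simp
    exact hG _ _

theorem computes_fixStep_zero {F : Term 0} {v w : List ℕ} (hw : w.headI = 0)
    (hF : Computes F v w) : Computes (.app (fixStep F) (fixStep F)) v w.tail := by
  intro k π
  refine .push ?_
  -- Only the copy of `fixStep F` in head position is to be unfolded.
  generalize hA : fixStep F = A
  nth_rewrite 1 [← hA]
  rw [fixStep]
  repeat first | with_reducible apply Evals.push | (with_reducible apply Evals.pop); simp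
  refine (hF _ _).trans ?_
  repeat first | with_reducible apply Evals.push | (with_reducible apply Evals.pop); simp
  cases w with
  | nil =>
    refine (evals_list_nil _ _ _).trans ?_
    exact Evals.push .refl
  | cons n w =>
    obtain rfl : n = 0 := hw
    refine (evals_list_cons _ _ _ _ _).trans ?_
    repeat first | with_reducible apply Evals.push | (with_reducible apply Evals.pop); simp
    refine (evals_numeral_zero _ _ _).trans ?_
    exact Evals.push .refl

theorem computes_fixStep_succ {F : Term 0} {v w x : List ℕ} (hw : w.headI ≠ 0)
    (hF : Computes F v w) (hx : Computes (.app (fixStep F) (fixStep F)) w.tail x) :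
    Computes (.app (fixStep F) (fixStep F)) v x := by
  intro k π
  refine .push ?_
  -- Only the copy of `fixStep F` in head position is to be unfolded.
  generalize hA : fixStep F = A at hx ⊢
  nth_rewrite 1 [← hA]
  rw [fixStep]
  repeat first | with_reducible apply Evals.push | (with_reducible apply Evals.pop); simp
  refine (hF _ _).trans ?_
  repeat first | with_reducible apply Evals.push | (with_reducible apply Evals.pop); simp
  cases w with
  | nil => exact (hw rfl).elim
  | cons m w =>
    obtain ⟨n, rfl⟩ : ∃ n, m = n + 1 := Nat.exists_eq_succ_of_ne_zero hw
    refine (evals_list_cons _ _ _ _ _).trans ?_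
    repeat first | with_reducible apply Evals.push | (with_reducible apply Evals.pop); simp
    refine (evals_numeral_succ _ _ _ _).trans ?_
    refine Evals.pop ?_
    simp
    exact Evals.push (.push (hx _ _))

open Turing.ToPartrec in
/-- Every partial recursive operation on lists of numbers is computed by a term. -/
theorem exists_computes (c : Code) : ∃ t : Term 0, ∀ v, ∀ w ∈ c.eval v, Computes t v w := by
  induction c with
  | zero' =>
    refine ⟨zeroTerm, fun v w hw => ?_⟩
    obtain rfl : w = 0 :: v := by simpa using! hw
    exact computes_zeroTerm v
  | succ =>
    refine ⟨succTerm, fun v w hw => ?_⟩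
    obtain rfl : w = [v.headI.succ] := by simpa using! hw
    exact computes_succTerm v
  | tail =>
    refine ⟨tailTerm, fun v w hw => ?_⟩
    obtain rfl : w = v.tail := by simpa using! hw
    exact computes_tailTerm v
  | cons f g hf hg =>
    obtain ⟨F, hF⟩ := hf
    obtain ⟨G, hG⟩ := hg
    refine ⟨consTerm F G, fun v w hw => ?_⟩
    obtain ⟨a, ha, b, hb, rfl⟩ : ∃ a ∈ f.eval v, ∃ b ∈ g.eval v, w = a.headI :: b := by
      simpa using! hw
    exact computes_consTerm (hF v a ha) (hG v b hb)
  | comp f g hf hg =>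
    obtain ⟨F, hF⟩ := hf
    obtain ⟨G, hG⟩ := hg
    refine ⟨compTerm F G, fun v w hw => ?_⟩
    obtain ⟨a, ha, hw⟩ : ∃ a ∈ g.eval v, w ∈ f.eval a := by
      rw [Code.comp_eval] at hw
      exact Part.mem_bind_iff.1 hw
    exact computes_compTerm (hF a w hw) (hG v a ha)
  | case f g hf hg =>
    obtain ⟨F, hF⟩ := hf
    obtain ⟨G, hG⟩ := hg
    refine ⟨caseTerm F G, fun v w hw => ?_⟩
    rw [Code.case_eval] at hw
    cases hn : v.headI with
    | zero =>
      simp only [hn] at hw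
      exact computes_caseTerm_zero hn (hF _ w hw)
    | succ n =>
      simp only [hn] at hw
      exact computes_caseTerm_succ hn (hG _ w hw)
  | fix f hf =>
    obtain ⟨F, hF⟩ := hf
    refine ⟨.app (fixStep F) (fixStep F), fun v w hw => ?_⟩
    rw [Code.fix_eval] at hw
    refine PFun.fixInduction hw fun u hu ih => ?_
    rcases PFun.mem_fix_iff.1 hu with h | ⟨u', h, -⟩
    · obtain ⟨a, ha, hs⟩ := (Part.mem_map_iff _).1 h
      by_cases h0 : a.headI = 0
      · rw [if_pos h0] at hs
        cases hs
        exact computes_fixStep_zero h0 (hF u a ha)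
      · simp [if_neg h0] at hs
    · obtain ⟨a, ha, hs⟩ := (Part.mem_map_iff _).1 h
      by_cases h0 : a.headI = 0
      · simp [if_pos h0] at hs
      · rw [if_neg h0] at hs
        cases hs
        exact computes_fixStep_succ h0 (hF u a ha) (ih _ h)

/-- Every partial recursive function is computed by a term. -/
theorem exists_computes_of_partrec {g : ℕ →. ℕ} (hg : Nat.Partrec g) :
    ∃ t : Term 0, ∀ n, ∀ m ∈ g n, Computes t [n] [m] := by
  obtain ⟨c, hc⟩ := Turing.ToPartrec.Code.exists_code
    (Nat.Partrec'.part_iff₁.2 (Partrec.nat_iff.2 hg))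
  obtain ⟨t, ht⟩ := exists_computes c
  refine ⟨t, fun n m hm => ht [n] [m] ?_⟩
  have := hc ⟨[n], rfl⟩
  simp only [List.Vector.head] at this
  rw [this]
  exact Part.mem_map _ hm

/-! ### Binary input and output -/

/-- The reflexive transitive closure of execution. -/
abbrev Execs : Ctx → Ctx → Prop := Relation.ReflTransGen Exec

theorem Evals.execs {p q : Proc} (h : Evals p q) (i o : List Bool) :
    Execs ⟨p, i, o⟩ ⟨q, i, o⟩ :=
  Relation.ReflTransGen.lift (fun p => (⟨p, i, o⟩ : Ctx)) (fun _ _ h => Exec.tau h i o) _ _ h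

theorem bin_zero : bin 0 = [] := by simp [bin]

theorem bin_two_mul {n : ℕ} (hn : n ≠ 0) : bin (2 * n) = bin n ++ [false] := by
  simp [bin, Nat.bit0_bits n hn]

theorem bin_two_mul_add_one (n : ℕ) : bin (2 * n + 1) = bin n ++ [true] := by
  simp [bin]

/-- Induction on the binary representation of a natural number. -/
theorem binary_induction {C : ℕ → Prop} (zero : C 0) (even : ∀ n, n ≠ 0 → C n → C (2 * n))
    (odd : ∀ n, C n → C (2 * n + 1)) (n : ℕ) : C n := by
  induction n using Nat.strong_induction_on with
  | _ n ih =>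
    rcases Nat.even_or_odd' n with ⟨m, rfl | rfl⟩
    · rcases Nat.eq_zero_or_pos m with rfl | hm
      · exact zero
      · exact even m hm.ne' (ih m (by omega))
    · exact odd m (ih m (by omega))

/-- The number obtained by appending the bits of `l` to the binary representation of `a`. -/
def ofBits (a : ℕ) (l : List Bool) : ℕ := l.foldl (fun a b => 2 * a + b.toNat) a

theorem ofBits_bin (n : ℕ) : ofBits 0 (bin n) = n := by
  induction n using binary_induction with
  | zero => simp [bin_zero, ofBits]
  | even n hn ih =>
    rw [bin_two_mul hn, ofBits, List.foldl_append]
    simpa [ofBits] using ih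
  | odd n ih =>
    rw [bin_two_mul_add_one, ofBits, List.foldl_append]
    simpa [ofBits] using ih

/-- `λ o v, T v (λ w, w end (λ h t, h end (λ h', h' (w0 (H v (o o))) (λ y, w1 (H v (o o))))))`.
If `T` computes `writeTag` and `H` halves, this term applied to itself writes a number in binary and
terminates. -/
def writeStep (T H : Term 0) : Term 0 := .lam (.lam (.app (.app T.weaken (.var 0))
  (.lam (.app (.app (.var 0) .halt) (.lam (.lam (.app (.app (.var 1) .halt)
    (.lam (.app (.app (.var 0)
      (.app .wr0 (.app (.app H.weaken (.var 4)) (.app (.var 5) (.var 5)))))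
      (.lam (.app .wr1 (.app (.app H.weaken (.var 5)) (.app (.var 6) (.var 6))))))))))))))

/-- `λ b v, r (D₀ v (b b)) (D₁ v (b b)) (G v W)`. If `D₀` and `D₁` append a bit to the binary
representation of a number, this term applied to itself and to a number appends all input bits to
that number, and passes control to `G` with continuation `W`. -/
def readStep (D₀ D₁ G W : Term 0) : Term 0 := .lam (.lam (.app (.app (.app .rd
  (.app (.app D₀.weaken (.var 0)) (.app (.var 1) (.var 1))))
  (.app (.app D₁.weaken (.var 0)) (.app (.var 1) (.var 1))))
  (.app (.app G.weaken (.var 0)) W.weaken)))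

/-- What to do in order to write `n` in binary, starting with the least significant bit: nothing
(`0`), or first write the bit `0` (`1`) or the bit `1` (`2`). -/
def writeTag (n : ℕ) : ℕ := if n = 0 then 0 else n % 2 + 1

theorem execs_writeStep {T H : Term 0} (hT : ∀ n, Computes T [n] [writeTag n])
    (hH : ∀ n, Computes H [n] [n / 2]) (n : ℕ) (π : Stack) (i o : List Bool) :
    Execs ⟨.star (.app (writeStep T H) (writeStep T H)) (.push (list [n]) π), i, o⟩
      ⟨.top, i, bin n ++ o⟩ := by
  -- Only the copy in head position is to be unfolded.
  generalize hA : writeStep T H = A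
  -- One round of the loop leaves the tag of `n` facing the two possible continuations.
  have start (n : ℕ) : Evals (.star (.app A A) (.push (list [n]) π))
      (.star (numeral (writeTag n)) (.push .halt (.push (.lam (.app (.app (.var 0)
        (.app .wr0 (.app (.app H.weaken (list [n]).weaken) (.app A.weaken A.weaken))))
        (.lam (.app .wr1 (.app (.app H.weaken (list [n]).weaken)
          (.app A.weaken A.weaken)))))) π))) := by
    refine .push ?_
    nth_rewrite 1 [← hA]
    rw [writeStep]
    repeat first | with_reducible apply Evals.push | (with_reducible apply Evals.pop); simp
    refine (hT n _ _).trans ?_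
    repeat first | with_reducible apply Evals.push | (with_reducible apply Evals.pop); simp
    refine (evals_list_cons _ _ _ _ _).trans ?_
    repeat first | with_reducible apply Evals.push | (with_reducible apply Evals.pop); simp
    exact .refl
  have start_succ (n b : ℕ) (h : writeTag n = b + 1) :
      Evals (.star (.app A A) (.push (list [n]) π)) (.star (numeral b)
        (.push (.app .wr0 (.app (.app H (list [n])) (.app A A)))
          (.push (.lam (.app .wr1 (.app (.app H.weaken (list [n]).weaken)
            (.app A.weaken A.weaken)))) π))) := by
    refine (start n).trans ?_
    rw [h]
    refine (evals_numeral_succ _ _ _ _).trans ?_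
    repeat first | with_reducible apply Evals.push | (with_reducible apply Evals.pop); simp
    exact .refl
  have half (n : ℕ) : Evals (.star (.app (.app H (list [n])) (.app A A)) π)
      (.star (.app A A) (.push (list [n / 2]) π)) := .push (.push (hH n _ _))
  induction n using binary_induction generalizing o with
  | zero =>
    refine ((start 0).execs i o).trans ?_
    refine ((evals_numeral_zero _ _ _).execs i o).trans ?_
    rw [bin_zero]
    exact .single (.halt _ _ _)
  | even n hn ih =>
    have h2 := half (2 * n)
    rw [show 2 * n / 2 = n by omega] at h2
    have ht : writeTag (2 * n) = 0 + 1 := by simp [writeTag, hn]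
    refine (Evals.execs ((start_succ _ 0 ht).trans (evals_numeral_zero _ _ _)) i o).trans ?_
    refine ((Evals.push .refl).execs i o).trans (.head (.wr0 _ _ _ _) ?_)
    rw [bin_two_mul hn, List.append_assoc]
    exact (h2.execs _ _).trans (ih _)
  | odd n ih =>
    have h2 := half (2 * n + 1)
    rw [show (2 * n + 1) / 2 = n by omega] at h2
    have ht : writeTag (2 * n + 1) = 1 + 1 := by simp [writeTag, Nat.add_mod]
    refine (Evals.execs ((start_succ _ 1 ht).trans (evals_numeral_succ _ _ _ _)) i o).trans ?_
    have hpop : Evals (.star (.lam (.app .wr1 (.app (.app H.weaken (list [2 * n + 1]).weaken)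
        (.app A.weaken A.weaken)))) (.push (numeral 0) π))
        (.star .wr1 (.push (.app (.app H (list [2 * n + 1])) (.app A A)) π)) := by
      repeat first | with_reducible apply Evals.push | (with_reducible apply Evals.pop); simp
      exact .refl
    refine (hpop.execs i o).trans (.head (.wr1 _ _ _ _) ?_)
    rw [bin_two_mul_add_one, List.append_assoc]
    exact (h2.execs _ _).trans (ih _)

theorem execs_readStep {D₀ D₁ G W : Term 0} (h₀ : ∀ n, Computes D₀ [n] [2 * n])
    (h₁ : ∀ n, Computes D₁ [n] [2 * n + 1]) (n : ℕ) (π : Stack) (i o : List Bool) :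
    Execs ⟨.star (.app (readStep D₀ D₁ G W) (readStep D₀ D₁ G W)) (.push (list [n]) π), i, o⟩
      ⟨.star (.app (.app G (list [ofBits n i])) W) π, [], o⟩ := by
  -- Only the copy in head position is to be unfolded.
  generalize hA : readStep D₀ D₁ G W = A
  have start (n : ℕ) : Evals (.star (.app A A) (.push (list [n]) π))
      (.star .rd (.push (.app (.app D₀ (list [n])) (.app A A))
        (.push (.app (.app D₁ (list [n])) (.app A A)) (.push (.app (.app G (list [n])) W) π)))) := by
    refine .push ?_
    nth_rewrite 1 [← hA]
    rw [readStep]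
    repeat first | with_reducible apply Evals.push | (with_reducible apply Evals.pop); simp
    exact .refl
  induction i generalizing n with
  | nil => exact ((start n).execs _ _).tail (.rdEmpty _ _ _ _ _)
  | cons b i ih =>
    cases b with
    | false =>
      refine (((start n).execs _ _).tail (.rd0 _ _ _ _ _ _)).trans ?_
      exact (Evals.execs (.push (.push (h₀ n _ _))) _ _).trans (ih _)
    | true =>
      refine (((start n).execs _ _).tail (.rd1 _ _ _ _ _ _)).trans ?_
      exact (Evals.execs (.push (.push (h₁ n _ _))) _ _).trans (ih _)

theorem primrec_writeTag : Primrec writeTag :=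
  Primrec.ite (Primrec.eq.comp .id (.const 0)) (.const 0)
    (Primrec.succ.comp (Primrec.nat_mod.comp .id (.const 2)))

/-- Every partial recursive function is implemented by a process. -/
theorem exists_implements {g : ℕ →. ℕ} (hg : Nat.Partrec g) : ∃ p, Implements p g := by
  have total {f : ℕ → ℕ} (hf : Primrec f) : ∃ t : Term 0, ∀ n, Computes t [n] [f n] := by
    obtain ⟨t, ht⟩ := exists_computes_of_partrec (Nat.Partrec.of_primrec (Primrec.nat_iff.1 hf))
    exact ⟨t, fun n => ht n _ (Part.mem_some _)⟩
  have double : Primrec (fun n => 2 * n) := Primrec.nat_mul.comp (.const 2) .id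
  obtain ⟨T, hT⟩ := total primrec_writeTag
  obtain ⟨H, hH⟩ := total (f := fun n => n / 2) (Primrec.nat_div.comp .id (.const 2))
  obtain ⟨D₀, h₀⟩ := total double
  obtain ⟨D₁, h₁⟩ := total (Primrec.succ.comp double)
  obtain ⟨G, hG⟩ := exists_computes_of_partrec hg
  let W : Term 0 := .app (writeStep T H) (writeStep T H)
  let R := readStep D₀ D₁ G W
  refine ⟨.star (.app R R) (.push (list [0]) .nil), fun n hn => ?_⟩
  have hread := execs_readStep (G := G) (W := W) h₀ h₁ 0 .nil (bin n) []
  rw [ofBits_bin] at hread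
  refine hread.trans ?_
  refine (Evals.execs (.push (.push (hG n _ (Part.get_mem hn) _ _))) _ _).trans ?_
  simpa using execs_writeStep hT hH ((g n).get hn) .nil [] []

/-! ### An environment machine on natural numbers -/

mutual

/-- A numbering of terms. -/
def Term.code : {n : ℕ} → Term n → ℕ
  | _, .var i => Nat.pair 0 i
  | _, .lam t => Nat.pair 1 t.code
  | _, .app t u => Nat.pair 2 (Nat.pair t.code u.code)
  | _, .cc => Nat.pair 3 0
  | _, .cont π => Nat.pair 4 π.code
  | _, .rd => Nat.pair 5 0
  | _, .wr0 => Nat.pair 6 0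
  | _, .wr1 => Nat.pair 7 0
  | _, .halt => Nat.pair 8 0

/-- A numbering of stacks, as lists of closures with an irrelevant environment. -/
def Stack.code : Stack → ℕ
  | .nil => 0
  | .push t π => Nat.pair (Nat.pair t.code 0) π.code

end

/-- The `i`-th entry of the list of numbers coded by `e` through iterated pairing; the list has no end
mark. -/
def lookup (e i : ℕ) : ℕ := ((fun e => e.unpair.2)^[i] e).unpair.1

theorem lookup_zero (h e : ℕ) : lookup (Nat.pair h e) 0 = h := by simp [lookup]

theorem lookup_succ (h e i : ℕ) : lookup (Nat.pair h e) (i + 1) = lookup e i := by simp [lookup]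

/-- A configuration of the environment machine: the head closure, the stack, the input and the
output. A closure is a pair of the code of an open term and an environment, which is a list of
closures. -/
abbrev Config : Type := ℕ × ℕ × List Bool × List Bool

/-- The tag of the head term of a configuration. -/
def Config.tag (c : Config) : ℕ := c.1.unpair.1.unpair.1

/-- One step of the environment machine, by cases on the tag of the head term. The configuration is
left unchanged if the head is `halt`. A stack that is too short for the head term yields a meaningless
configuration; only transitions that the original machine can make have to be simulated. -/
def step (c : Config) : Config :=
  let a := c.1.unpair.1.unpair.2
  let e := c.1.unpair.2
  let h := c.2.1.unpair.1
  let s := c.2.1.unpair.2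
  let i := c.2.2.1
  let o := c.2.2.2
  if c.tag = 0 then (lookup e a, c.2)
  else if c.tag = 1 then (Nat.pair a (Nat.pair h e), s, i, o)
  else if c.tag = 2 then
    (Nat.pair a.unpair.1 e, Nat.pair (Nat.pair a.unpair.2 e) c.2.1, i, o)
  else if c.tag = 3 then (h, Nat.pair (Nat.pair (Nat.pair 4 s) 0) s, i, o)
  else if c.tag = 4 then (h, a, i, o)
  else if c.tag = 5 then
    (if i.head? = some false then h else if i.head? = some true then s.unpair.1
      else s.unpair.2.unpair.1, s.unpair.2.unpair.2, i.tail, o)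
  else if c.tag = 6 then (h, s, i, false :: o)
  else if c.tag = 7 then (h, s, i, true :: o)
  else c

open Primrec in
theorem primrec_step : Primrec step := by
  have fst : Primrec fun n : ℕ => n.unpair.1 := Primrec.fst.comp .unpair
  have snd : Primrec fun n : ℕ => n.unpair.2 := Primrec.snd.comp .unpair
  have pair {f g : Config → ℕ} (hf : Primrec f) (hg : Primrec g) :
      Primrec fun c => Nat.pair (f c) (g c) := Primrec₂.natPair.comp hf hg
  have head : Primrec fun c : Config => c.1 := .fst
  have code := fst.comp head
  have tag : Primrec Config.tag := fst.comp code
  have a := snd.comp code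
  have e := snd.comp head
  have st : Primrec fun c : Config => c.2.1 := Primrec.fst.comp .snd
  have h := fst.comp st
  have s := snd.comp st
  have s₂ := snd.comp s
  have io : Primrec fun c : Config => c.2.2 := Primrec.snd.comp .snd
  have i := Primrec.fst.comp io
  have o := Primrec.snd.comp io
  have is (k : ℕ) : PrimrecPred fun c : Config => c.tag = k := Primrec.eq.comp tag (.const k)
  have hd := list_head?.comp i
  have look : Primrec fun c : Config => lookup c.1.unpair.2 c.1.unpair.1.unpair.2 :=
    fst.comp (nat_iterate a e (snd.comp Primrec.snd).to₂)
  exact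
    .ite (is 0) (look.pair .snd) <|
    .ite (is 1) ((pair a (pair h e)).pair (s.pair io)) <|
    .ite (is 2) ((pair (fst.comp a) e).pair ((pair (pair (snd.comp a) e) st).pair io)) <|
    .ite (is 3) (h.pair ((pair (pair (pair (.const 4) s) (.const 0)) s).pair io)) <|
    .ite (is 4) (h.pair (a.pair io)) <|
    .ite (is 5) ((Primrec.ite (Primrec.eq.comp hd (.const _)) h
      (.ite (Primrec.eq.comp hd (.const _)) (fst.comp s) (fst.comp s₂))).pair
      ((snd.comp s₂).pair ((list_tail.comp i).pair o))) <|
    .ite (is 6) (h.pair (s.pair (i.pair (list_cons.comp (.const false) o)))) <|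
    .ite (is 7) (h.pair (s.pair (i.pair (list_cons.comp (.const true) o)))) .id

mutual

/-- The number `h` represents the closed term `t` as a closure. The environment of a continuation is
irrelevant. -/
inductive RepTerm : ℕ → Term 0 → Prop
  | closure {n : ℕ} (t : Term n) (σ : Fin n → Term 0) (e : ℕ)
      (h : ∀ i : Fin n, RepTerm (lookup e i) (σ i)) : RepTerm (Nat.pair t.code e) (t.subst σ)
  | cont {s : ℕ} {π : Stack} (e : ℕ) (h : RepStack s π) :
      RepTerm (Nat.pair (Nat.pair 4 s) e) (.cont π)

/-- The number `s` represents the stack `π` as a list of closures. The end of the list is not marked: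
every number represents the empty stack. -/
inductive RepStack : ℕ → Stack → Prop
  | nil (s : ℕ) : RepStack s .nil
  | push {h s : ℕ} {t : Term 0} {π : Stack} (ht : RepTerm h t) (hs : RepStack s π) :
      RepStack (Nat.pair h s) (.push t π)

end

theorem repTerm_code (t : Term 0) : RepTerm (Nat.pair t.code 0) t := by
  have := RepTerm.closure t Fin.elim0 0 (fun i => i.elim0)
  rwa [Term.subst_closed, Term.weaken_zero] at this

theorem repStack_code : (π : Stack) → RepStack π.code π
  | .nil => by rw [Stack.code]; exact .nil 0
  | .push t π => by rw [Stack.code]; exact .push (repTerm_code t) (repStack_code π)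

/-- The number `h` represents the closed term `t` as a closure whose term is not a variable. -/
inductive RepHead : ℕ → Term 0 → Prop
  | lam {n : ℕ} (t : Term (n + 1)) (σ : Fin n → Term 0) (e : ℕ)
      (h : ∀ i : Fin n, RepTerm (lookup e i) (σ i)) :
      RepHead (Nat.pair (Nat.pair 1 t.code) e) (.lam (t.subst (liftS σ)))
  | app {n : ℕ} (t u : Term n) (σ : Fin n → Term 0) (e : ℕ)
      (h : ∀ i : Fin n, RepTerm (lookup e i) (σ i)) :
      RepHead (Nat.pair (Nat.pair 2 (Nat.pair t.code u.code)) e) (.app (t.subst σ) (u.subst σ))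
  | cc (e : ℕ) : RepHead (Nat.pair (Nat.pair 3 0) e) .cc
  | cont {s : ℕ} {π : Stack} (e : ℕ) (h : RepStack s π) :
      RepHead (Nat.pair (Nat.pair 4 s) e) (.cont π)
  | rd (e : ℕ) : RepHead (Nat.pair (Nat.pair 5 0) e) .rd
  | wr0 (e : ℕ) : RepHead (Nat.pair (Nat.pair 6 0) e) .wr0
  | wr1 (e : ℕ) : RepHead (Nat.pair (Nat.pair 7 0) e) .wr1
  | halt (e : ℕ) : RepHead (Nat.pair (Nat.pair 8 0) e) .halt

/-- The environment machine resolves a variable in head position by finitely many lookups. -/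
theorem RepTerm.exists_repHead {h : ℕ} {t : Term 0} (ht : RepTerm h t) :
    ∃ (k h' : ℕ), RepHead h' t ∧ ∀ x, step^[k] (h, x) = (h', x) := by
  match ht with
  | .closure (.var i) σ e hσ =>
    obtain ⟨k, h', hh, hk⟩ := (hσ i).exists_repHead
    refine ⟨k + 1, h', hh, fun x => ?_⟩
    rw [Function.iterate_succ_apply, ← hk]
    simp [step, Config.tag, Term.code]
  | .closure (.lam t) σ e hσ =>
    exact ⟨0, _, by simpa only [Term.code, Term.subst] using .lam t σ e hσ, fun _ => rfl⟩
  | .closure (.app t u) σ e hσ =>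
    exact ⟨0, _, by simpa [Term.code, Term.subst] using .app t u σ e hσ, fun _ => rfl⟩
  | .closure .cc σ e _ => exact ⟨0, _, by simpa [Term.code, Term.subst] using .cc e, fun _ => rfl⟩
  | .closure (.cont π) σ e _ =>
    exact ⟨0, _, by simpa [Term.code, Term.subst] using .cont e (repStack_code π), fun _ => rfl⟩
  | .closure .rd σ e _ => exact ⟨0, _, by simpa [Term.code, Term.subst] using .rd e, fun _ => rfl⟩
  | .closure .wr0 σ e _ =>
    exact ⟨0, _, by simpa [Term.code, Term.subst] using .wr0 e, fun _ => rfl⟩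
  | .closure .wr1 σ e _ =>
    exact ⟨0, _, by simpa [Term.code, Term.subst] using .wr1 e, fun _ => rfl⟩
  | .closure .halt σ e _ =>
    exact ⟨0, _, by simpa [Term.code, Term.subst] using .halt e, fun _ => rfl⟩
  | .cont e h => exact ⟨0, _, .cont e h, fun _ => rfl⟩

/-- The configuration `x` represents the execution context `c`. A context at `top` is represented
by the configurations with head `halt`. -/
inductive Rep : Config → Ctx → Prop
  | star {h s : ℕ} {t : Term 0} {π : Stack} (ht : RepTerm h t) (hs : RepStack s π)
      (i o : List Bool) : Rep (h, s, i, o) ⟨.star t π, i, o⟩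
  | top (e s : ℕ) (i o : List Bool) :
      Rep (Nat.pair (Nat.pair 8 0) e, s, i, o) ⟨.top, i, o⟩

/-- If the head closure is not a variable, every machine transition is simulated by at most one step
of the environment machine. -/
theorem Rep.step_of_repHead {h s : ℕ} {t : Term 0} {π : Stack} {i o : List Bool} {d : Ctx}
    (ht : RepHead h t) (hs : RepStack s π) (hd : Exec ⟨.star t π, i, o⟩ d) :
    Rep (step (h, s, i, o)) d := by
  cases hd with
  | tau hd =>
    cases hd with
    | push t u π =>
      cases ht with
      | app t u σ e hσ =>
        simpa [step, Config.tag] using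
          Rep.star (.closure t σ e hσ) (.push (.closure u σ e hσ) hs) i o
    | pop t u π =>
      cases ht with
      | lam t σ e hσ =>
        cases hs with
        | push hu hs =>
          rw [Term.inst_subst_lift]
          simp only [step, Config.tag, Nat.unpair_pair]
          refine .star (.closure t _ _ fun i => ?_) hs _ _
          cases i using Fin.cases with
          | zero => simpa [lookup_zero] using hu
          | succ i => simpa [lookup_succ] using hσ i
    | save t π =>
      cases ht with
      | cc e =>
        cases hs with
        | push ht hs =>
          simpa [step, Config.tag] using Rep.star ht (.push (.cont 0 hs) hs) i o
    | restore π t ρ =>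
      cases ht with
      | cont e hπ =>
        cases hs with
        | push ht hs => simpa [step, Config.tag] using Rep.star ht hπ i o
  | rd0 t u v π i =>
    cases ht with
    | rd e =>
      obtain _ | ⟨ht, _ | ⟨hu, _ | ⟨hv, hs⟩⟩⟩ := hs
      simpa [step, Config.tag] using Rep.star ht hs i o
  | rd1 t u v π i =>
    cases ht with
    | rd e =>
      obtain _ | ⟨ht, _ | ⟨hu, _ | ⟨hv, hs⟩⟩⟩ := hs
      simpa [step, Config.tag] using Rep.star hu hs i o
  | rdEmpty t u v π =>
    cases ht with
    | rd e =>
      obtain _ | ⟨ht, _ | ⟨hu, _ | ⟨hv, hs⟩⟩⟩ := hs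
      simpa [step, Config.tag] using Rep.star hv hs [] o
  | wr0 t π =>
    cases ht with
    | wr0 e =>
      obtain _ | ⟨ht, hs⟩ := hs
      simpa [step, Config.tag] using Rep.star ht hs i (false :: o)
  | wr1 t π =>
    cases ht with
    | wr1 e =>
      obtain _ | ⟨ht, hs⟩ := hs
      simpa [step, Config.tag] using Rep.star ht hs i (true :: o)
  | halt π =>
    cases ht with
    | halt e => simpa [step, Config.tag] using Rep.top e s i o

theorem Rep.exists_of_exec {x : Config} {c d : Ctx} (hx : Rep x c) (h : Exec c d) :
    ∃ k, Rep (step^[k] x) d := by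
  cases hx with
  | star ht hs i o =>
    obtain ⟨k, h', hh, hk⟩ := ht.exists_repHead
    refine ⟨k + 1, ?_⟩
    rw [Function.iterate_succ_apply', hk]
    exact Rep.step_of_repHead hh hs h
  | top e s i o => nomatch h

theorem Rep.exists_of_execs {x : Config} {c d : Ctx} (hx : Rep x c) (h : Execs c d) :
    ∃ k, Rep (step^[k] x) d := by
  induction h with
  | refl => exact ⟨0, hx⟩
  | tail _ h ih =>
    obtain ⟨k, hk⟩ := ih
    obtain ⟨l, hl⟩ := hk.exists_of_exec h
    exact ⟨l + k, by rwa [Function.iterate_add_apply]⟩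

/-! ### Computability of implemented functions -/

theorem primrec_bin : Primrec bin := by
  -- Each iteration moves the least significant bit to the front of the list; `n` iterations suffice.
  let f : ℕ × List Bool → ℕ × List Bool := fun p =>
    if p.1 = 0 then p else (p.1 / 2, (decide (p.1 % 2 = 1)) :: p.2)
  have hf : Primrec f :=
    .ite (Primrec.eq.comp .fst (.const 0)) .id
      ((Primrec.nat_div.comp .fst (.const 2)).pair (Primrec.list_cons.comp
        (PrimrecPred.decide (Primrec.eq.comp (Primrec.nat_mod.comp .fst (.const 2)) (.const 1))) .snd))
  have key (n : ℕ) : ∀ k l, n ≤ k → f^[k] (n, l) = (0, bin n ++ l) := by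
    induction n using binary_induction with
    | zero =>
      intro k l _
      rw [bin_zero]
      exact Function.iterate_fixed (by simp [f]) k
    | even n hn ih =>
      intro k l hk
      obtain ⟨k, rfl⟩ : ∃ j, k = j + 1 := ⟨k - 1, by omega⟩
      rw [Function.iterate_succ_apply, bin_two_mul hn, List.append_assoc]
      have : f (2 * n, l) = (n, false :: l) := by simp [f, hn]
      rw [this]
      exact ih k _ (by omega)
    | odd n ih =>
      intro k l hk
      obtain ⟨k, rfl⟩ : ∃ j, k = j + 1 := ⟨k - 1, by omega⟩
      rw [Function.iterate_succ_apply, bin_two_mul_add_one, List.append_assoc]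
      have : f (2 * n + 1, l) = (n, true :: l) := by
        simp only [f]
        rw [if_neg (by omega), show (2 * n + 1) / 2 = n by omega]
        simp [Nat.add_mod]
      rw [this]
      exact ih k _ (by omega)
  refine (Primrec.snd.comp (Primrec.nat_iterate .id (Primrec.id.pair (.const []))
    (hf.comp .snd).to₂)).of_eq fun n => ?_
  simp [key n n [] le_rfl]

theorem primrec_ofBits : Primrec (ofBits 0) := by
  have hb : Primrec Bool.toNat :=
    (Primrec.cond .id (.const 1) (.const 0)).of_eq fun b => by cases b <;> rfl
  exact Primrec.list_foldl .id (.const 0)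
    (Primrec.nat_add.comp (Primrec.nat_mul.comp (.const 2) (Primrec.fst.comp .snd))
      (hb.comp (Primrec.snd.comp .snd))).to₂

/-- An implemented function has a partial recursive extension: run the environment machine until
the head is `halt`, and decode the output. -/
theorem exists_partrec_of_implements {p : Proc} {f : ℕ →. ℕ} (hp : Implements p f) :
    ∃ g : ℕ →. ℕ, Nat.Partrec g ∧ ∀ n m : ℕ, m ∈ f n → m ∈ g n := by
  obtain ⟨h, s, hrep⟩ : ∃ h s, ∀ i, Rep (h, s, i, []) ⟨p, i, []⟩ := by
    cases p with
    | star t π => exact ⟨_, _, fun i => .star (repTerm_code t) (repStack_code π) i []⟩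
    | top => exact ⟨_, _, fun i => .top 0 0 i []⟩
  let run (n k : ℕ) : Config := step^[k] (h, s, bin n, [])
  have hrun : Primrec₂ run :=
    Primrec.nat_iterate .snd ((Primrec.const h).pair ((Primrec.const s).pair
      ((primrec_bin.comp .fst).pair (.const [])))) (primrec_step.comp .snd).to₂
  have htag : Primrec Config.tag :=
    Primrec.fst.comp (Primrec.unpair.comp (Primrec.fst.comp (Primrec.unpair.comp .fst)))
  have hhalt : Primrec₂ fun n k => decide ((run n k).tag = 8) :=
    (PrimrecPred.decide (Primrec.eq.comp (htag.comp hrun) (.const 8))).to₂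
  have hout : Primrec₂ fun n k => ofBits 0 (run n k).2.2.2 :=
    primrec_ofBits.comp (Primrec.snd.comp (Primrec.snd.comp (Primrec.snd.comp hrun)))
  refine ⟨fun n => (Nat.rfind fun k => Part.some (decide ((run n k).tag = 8))).map
    fun k => ofBits 0 (run n k).2.2.2, Partrec.nat_iff.1
      ((Partrec.rfind hhalt.to_comp.partrec₂).map hout.to_comp), ?_⟩
  rintro n _ ⟨hn, rfl⟩
  obtain ⟨k, hk⟩ := (hrep (bin n)).exists_of_execs (hp n hn)
  change Rep (run n k) _ at hk
  generalize hx : run n k = x at hk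
  obtain _ | ⟨e, s', i, o⟩ := hk
  have hk8 : (run n k).tag = 8 := by rw [hx]; simp [Config.tag]
  have hdom : (Nat.rfind fun k => Part.some (decide ((run n k).tag = 8))).Dom :=
    Nat.rfind_dom.2 ⟨k, by simpa using hk8, fun _ => trivial⟩
  obtain ⟨j, hj⟩ := Part.dom_iff_mem.1 hdom
  have hj8 : (run n j).tag = 8 := by simpa using Nat.rfind_spec hj
  have hjk : j ≤ k := by
    by_contra hlt
    simpa [hk8] using Nat.rfind_min hj (not_le.1 hlt)
  -- A configuration with head `halt` is a fixed point, so the output at time `j` is final.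
  have hfix : step (run n j) = run n j := by simp [step, hj8]
  have hjk' : run n k = run n j := by
    obtain ⟨l, rfl⟩ := Nat.exists_eq_add_of_le' hjk
    change step^[l + j] _ = _
    rw [Function.iterate_add_apply]
    exact Function.iterate_fixed hfix l
  refine (Part.mem_map_iff _).2 ⟨j, hj, ?_⟩
  rw [← hjk', hx]
  exact ofBits_bin _

theorem nonempty_implPole_iff (f : ℕ →. ℕ) : (implPole f).carrier.Nonempty ↔
    ∃ g : ℕ →. ℕ, Nat.Partrec g ∧ ∀ n m : ℕ, m ∈ f n → m ∈ g n := by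
  constructor
  · rintro ⟨p, hp⟩
    exact exists_partrec_of_implements hp
  · rintro ⟨g, hg, hfg⟩
    obtain ⟨p, hp⟩ := exists_implements hg
    refine ⟨p, fun n hn => ?_⟩
    obtain ⟨hn', h⟩ := hfg n _ (Part.get_mem hn)
    exact h ▸ hp n hn'

/-- The restriction of a partial recursive function to a recursively enumerable set is partial
recursive. -/
theorem partrec_of_rePred_dom {f g : ℕ →. ℕ} (hf : REPred fun n => (f n).Dom) (hg : Nat.Partrec g)
    (hfg : ∀ n m : ℕ, m ∈ f n → m ∈ g n) : Nat.Partrec f := by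
  refine Partrec.nat_iff.1 ((Partrec.bind hf ((Partrec.nat_iff.2 hg).comp .fst).to₂).of_eq
    fun n => Part.ext fun m => ?_)
  simp only [Part.mem_bind_iff, Part.mem_assert_iff]
  constructor
  · rintro ⟨_, ⟨hn, -⟩, hm⟩
    exact Part.mem_unique hm (hfg n _ (Part.get_mem hn)) ▸ Part.get_mem hn
  · intro hm
    exact ⟨(), ⟨Part.dom_iff_mem.2 ⟨m, hm⟩, Part.mem_some _⟩, hfg n m hm⟩

end Krivine

theorem mainTheorem2 (f : ℕ →. ℕ) :
    (Krivine.Consistent (Krivine.implPole f) ↔ ∃ n : ℕ, (f n).Dom) ∧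
    ((Krivine.implPole f).carrier.Nonempty ↔
      ∃ g : ℕ →. ℕ, Nat.Partrec g ∧ ∀ n m : ℕ, m ∈ f n → m ∈ g n) ∧
    (Nat.Partrec f → (Krivine.implPole f).carrier.Nonempty) ∧
    (REPred (fun n : ℕ => (f n).Dom) →
      ((Krivine.implPole f).carrier.Nonempty ↔ Nat.Partrec f)) := by
  have partrec (hf : Nat.Partrec f) : (Krivine.implPole f).carrier.Nonempty :=
    (Krivine.nonempty_implPole_iff f).2 ⟨f, hf, fun _ _ h => h⟩
  refine ⟨Krivine.consistent_implPole_iff f, Krivine.nonempty_implPole_iff f, partrec,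
    fun hdom => ⟨fun h => ?_, partrec⟩⟩
  obtain ⟨g, hg, hfg⟩ := (Krivine.nonempty_implPole_iff f).1 h
  exact Krivine.partrec_of_rePred_dom hdom hg hfg
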